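/- Let $n\ge 2$ and $m$ be integers, let $\Omega=\{(i,j):1\le i<j\le n\}$, and let $X_1,\dots,X_m$ be independent random $n\times n$ matrices with the uniform law $\mathbb P\big(X_l=\tfrac12(e_ie_j^T+e_je_i^T)\big)=1/|\Omega|$ for all $(i,j)\in\Omega$; let $X$ denote a generic random matrix with this law. For real symmetric $A,B$ put $\langle A,B\rangle=\mathrm{trace}(AB)$ and $\|A\|=\sqrt{\langle A,A\rangle}$; let $\|A\|_*$ be the nuclear norm (the sum of the singular values) and $\|A\|_\infty=\max_{i,j}|A_{ij}|$. Let $\mathcal O(A)=(\langle X_1,A\rangle,\dots,\langle X_m,A\rangle)^T\in\mathbb R^m$, with the Euclidean norm on $\mathbb R^m$. For $\tau>0$ let $\mathcal C(\tau)$ be the set of all real symmetric $n\times n$ matrices $A$ with zero diagonal such that $$\|A\|_\infty=\frac1{\sqrt2},\qquad \|A\|_*\le\sqrt\tau\,\|A\|,\qquad \mathbb E\big(\langle A,X\rangle^2\big)\ge\sqrt{\frac{256\log(2n)}{m\log 2}} .$$ There is an absolute constant $C_2>0$ such that for every $C_1>1$, every $\tau>0$ and all $n\ge2$ and $m>C_1\,n\log(2n)$,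 with probability at least $1-1/n$ the inequality $$\frac1m\|\mathcal O(A)\|^2\ \ge\ \frac12\,\mathbb E\big(\langle A,X\rangle^2\big)-256\,C_2\,\tau\,|\Omega|\,\frac{\log(2n)}{nm}$$ holds simultaneously for all $A\in\mathcal C(\tau)$. -/

import Mathlib

open MeasureTheory ProbabilityTheory

namespace EDMSampling

/-- The index set `Ω = {(i, j) : i < j}`. -/
def pairs (n : ℕ) : Finset (Fin n × Fin n) :=
  Finset.univ.filter fun p => p.1 < p.2

/-- The trace inner product `⟨A, B⟩ = trace (A B)` of symmetric matrices. -/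
def traceInner {n : ℕ} (A B : Matrix (Fin n) (Fin n) ℝ) : ℝ :=
  (A * B).trace

/-- The norm `‖A‖` induced by the trace inner product: the Frobenius norm of a symmetric matrix. -/
noncomputable def frobNorm {n : ℕ} (A : Matrix (Fin n) (Fin n) ℝ) : ℝ :=
  √(traceInner A A)

/-- The infinity norm `‖A‖_∞`: the largest absolute value of an entry. -/
noncomputable def maxNorm {n : ℕ} (A : Matrix (Fin n) (Fin n) ℝ) : ℝ :=
  ⨆ p : Fin n × Fin n, |A p.1 p.2|

/-- The nuclear norm `‖A‖_*`: the sum of the `n` singular values. -/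
noncomputable def nuclearNorm {n : ℕ} (A : Matrix (Fin n) (Fin n) ℝ) : ℝ :=
  ∑ i ∈ Finset.range n, (Matrix.toEuclideanLin A).singularValues i

/-- The sampling basis matrix `½ (e_i e_jᵀ + e_j e_iᵀ)` of the pair `p = (i, j)`. -/
noncomputable def basisMatrix {n : ℕ} (p : Fin n × Fin n) : Matrix (Fin n) (Fin n) ℝ :=
  (1 / 2 : ℝ) • (Matrix.single p.1 p.2 1 + Matrix.single p.2 p.1 1)

/-- The product (equivalently, Borel) σ-algebra on the space of matrices. -/
instance matrixMeasurableSpace (n : ℕ) : MeasurableSpace (Matrix (Fin n) (Fin n) ℝ) :=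
  inferInstanceAs (MeasurableSpace (Fin n → Fin n → ℝ))

/-- The uniform sampling law: each sampling basis matrix indexed by `Ω` has mass `1 / |Ω|`. -/
noncomputable def uniformLaw (n : ℕ) : Measure (Matrix (Fin n) (Fin n) ℝ) :=
  ((pairs n).card : ENNReal)⁻¹ • ∑ p ∈ pairs n, Measure.dirac (basisMatrix p)

/-- `E(⟨A, X⟩²)`, where `X` is distributed according to the uniform sampling law. -/
noncomputable def secondMoment {n : ℕ} (A : Matrix (Fin n) (Fin n) ℝ) : ℝ :=
  ∫ M, traceInner A M ^ 2 ∂(uniformLaw n)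

/-- The observation operator `O(A) = (⟨X_1, A⟩, …, ⟨X_m, A⟩)`, with values in Euclidean space. -/
noncomputable def observe {n m : ℕ} (X : Fin m → Matrix (Fin n) (Fin n) ℝ)
    (A : Matrix (Fin n) (Fin n) ℝ) : EuclideanSpace ℝ (Fin m) :=
  WithLp.toLp 2 fun l => traceInner (X l) A

/-- The set `C(τ)` for matrices of size `n` and sample size `m`. -/
def coneSet (n m : ℕ) (τ : ℝ) : Set (Matrix (Fin n) (Fin n) ℝ) :=
  {A | A.IsSymm ∧ (∀ i, A i i = 0) ∧ maxNorm A = 1 / √2 ∧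
    nuclearNorm A ≤ √τ * frobNorm A ∧
    √(256 * Real.log (2 * n) / (m * Real.log 2)) ≤ secondMoment A}

end EDMSampling

/-! Since `X` takes finitely many values, probabilities become counts of index tuples `w : Fin m →
pairs n`; on symmetric `A` the observations are the entries `A i j` at the sampled pairs.

Write E for the second moment of `A` and R for the subtracted error. Failure means that the
empirical sum of `A i j ^ 2` is below m(E/2 - R) for some `A`. The lower bound on E makes each fixed
sum reach 3mE/4 for at least half of the samples (`lower_tail_count`), so comparison with an
independent copy and random signs (`symmetrization_count`) reduces failure to: some `A` has signed
sum at least mE/8 + mR/2.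

The term mE/8 is kept as an offset inside the supremum, so no peeling over the size of E is needed.
Markov's inequality for the `p`-th power of the positive part, and `contraction`, which tolerates an
offset, replace `A i j ^ 2` by √2 `A i j`, a linear process. Trace duality bounds it by √2 times the
nuclear norm of `A` times the operator norm y of a Rademacher sum of basis matrices. As the nuclear
norm is at most √τ times the Frobenius norm, whose square is 2|Ω|E, completing the square absorbs it
into the offset and leaves 8τ|Ω|y²/m (`offset_bound`).

Moments of y follow from a matrix Khintchine inequality. The squares of the basis matrices sum to a
quarter of the diagonal matrix of sampled degrees, and a Chernoff bound keeps all degrees below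
8m/n. Taking `p` near log(2n) makes the exceptional proportion polynomially small in n. -/

namespace EDMSampling

/-! ### Signs and the contraction principle -/

/-- The real sign attached to a Boolean. -/
def sgn (b : Bool) : ℝ := if b then 1 else -1

@[simp] lemma sgn_true : sgn true = 1 := by simp [sgn]

@[simp] lemma sgn_false : sgn false = -1 := by simp [sgn]

lemma sgn_not (b : Bool) : sgn (!b) = -sgn b := by cases b <;> simp

lemma sgn_mul_self (b : Bool) : sgn b * sgn b = 1 := by cases b <;> simp

/-- If the larger of α, β lies between c and d, it is a convex combination of them, and the other is
at most the mirrored combination. Adding the two convexity inequalities gives the bound; otherwise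
monotonicity alone suffices. -/
lemma add_le_add_of_weak_majorization {F : ℝ → ℝ} (hF : ConvexOn ℝ Set.univ F)
    (hmono : Monotone F) {α β c d : ℝ} (hα : α ≤ max c d) (hβ : β ≤ max c d)
    (hsum : α + β ≤ c + d) : F α + F β ≤ F c + F d := by
  wlog hcd : c ≤ d generalizing c d
  · have := this (c := d) (d := c) (by rwa [max_comm]) (by rwa [max_comm]) (by linarith)
      (le_of_not_ge hcd)
    linarith
  wlog hαβ : α ≤ β generalizing α β
  · have := this hβ hα (by linarith) (le_of_not_ge hαβ)
    linarith
  rw [max_eq_right hcd] at hα hβ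
  rcases le_or_gt β c with h | h
  · exact add_le_add (hmono (hαβ.trans h)) (hmono hβ)
  have hpos : 0 < d - c := by linarith
  set t := (d - β) / (d - c) with ht
  have ht0 : 0 ≤ t := div_nonneg (by linarith) hpos.le
  have ht1 : 0 ≤ 1 - t := by
    rw [ht, sub_nonneg, div_le_one hpos]; linarith
  have hb : t * c + (1 - t) * d = β := by
    rw [ht]; field_simp; ring
  have h1 := hF.2 (Set.mem_univ c) (Set.mem_univ d) ht0 ht1 (by ring)
  have h2 := hF.2 (Set.mem_univ c) (Set.mem_univ d) ht1 ht0 (by ring)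
  simp only [smul_eq_mul] at h1 h2
  rw [hb] at h1
  have h3 : F α ≤ F ((1 - t) * c + t * d) := hmono (by linarith)
  linarith

section Contraction

variable {ι : Type*} [Finite ι] [Nonempty ι] {F : ℝ → ℝ}

/-- Maximisers t and s of the two left suprema give values individually below the larger right
supremum. Their sum is bounded by testing the right suprema at t and s, in the order dictated by the
sign of `x t - x s`. This is weak majorization. -/
lemma contraction_step (hF : ConvexOn ℝ Set.univ F) (hmono : Monotone F) (a u x : ι → ℝ)
    (hu : ∀ t, |u t| ≤ |x t|) (hux : ∀ s t, |u s - u t| ≤ |x s - x t|) :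
    F (⨆ t, (a t + u t)) + F (⨆ t, (a t - u t)) ≤
      F (⨆ t, (a t + x t)) + F (⨆ t, (a t - x t)) := by
  have hp : ∀ t, a t + x t ≤ ⨆ t, (a t + x t) := le_ciSup (Set.finite_range _).bddAbove
  have hm : ∀ t, a t - x t ≤ ⨆ t, (a t - x t) := le_ciSup (Set.finite_range _).bddAbove
  obtain ⟨t, ht⟩ := exists_eq_ciSup_of_finite (f := fun t => a t + u t)
  obtain ⟨s, hs⟩ := exists_eq_ciSup_of_finite (f := fun t => a t - u t)
  have key : ∀ r, a r + |x r| ≤ max (⨆ t, (a t + x t)) (⨆ t, (a t - x t)) := by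
    intro r
    rcases abs_cases (x r) with h | h
    · exact le_max_of_le_left (by linarith [hp r])
    · exact le_max_of_le_right (by linarith [hm r])
  rw [← ht, ← hs]
  apply add_le_add_of_weak_majorization hF hmono
  · linarith [key t, hu t, le_abs_self (u t)]
  · linarith [key s, hu s, neg_abs_le (u s)]
  · have h1 := (le_abs_self _).trans (hux t s)
    rcases abs_cases (x t - x s) with h | h
    · linarith [hp t, hm s]
    · linarith [hp s, hm t]

/-- The Ledoux–Talagrand contraction principle for Rademacher averages, with an offset. -/
theorem contraction (hF : ConvexOn ℝ Set.univ F) (hmono : Monotone F) (m : ℕ) :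
    ∀ (a : ι → ℝ) (u x : Fin m → ι → ℝ), (∀ l t, |u l t| ≤ |x l t|) →
      (∀ l s t, |u l s - u l t| ≤ |x l s - x l t|) →
      ∑ ε : Fin m → Bool, F (⨆ t, (a t + ∑ l, sgn (ε l) * u l t)) ≤
        ∑ ε : Fin m → Bool, F (⨆ t, (a t + ∑ l, sgn (ε l) * x l t)) := by
  induction m with
  | zero => intro a u x _ _; simp
  | succ m ih =>
    intro a u x hu hux
    have split : ∀ v : Fin (m + 1) → ι → ℝ,
        ∑ ε : Fin (m + 1) → Bool, F (⨆ t, (a t + ∑ l, sgn (ε l) * v l t)) =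
          ∑ b : Bool, ∑ ε : Fin m → Bool,
            F (⨆ t, (a t + sgn b * v 0 t + ∑ l : Fin m, sgn (ε l) * v l.succ t)) := by
      intro v
      rw [← (Fin.consEquiv fun _ => Bool).sum_comp, Fintype.sum_prod_type]
      refine Finset.sum_congr rfl fun b _ => Finset.sum_congr rfl fun ε _ => ?_
      simp [Fin.consEquiv, Fin.sum_univ_succ, add_assoc]
    rw [split, split]
    -- The induction hypothesis contracts the tail with the head term moved into the offset; the
    -- two-point step then contracts the head with the tail in the offset.
    calc _ ≤ ∑ b : Bool, ∑ ε : Fin m → Bool,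
            F (⨆ t, (a t + sgn b * u 0 t + ∑ l : Fin m, sgn (ε l) * x l.succ t)) :=
          Finset.sum_le_sum fun b _ => ih (fun t => a t + sgn b * u 0 t) (fun l => u l.succ)
            (fun l => x l.succ) (fun l => hu l.succ) (fun l => hux l.succ)
      _ ≤ _ := by
          rw [Finset.sum_comm, Finset.sum_comm (s := (Finset.univ : Finset Bool))]
          refine Finset.sum_le_sum fun ε _ => ?_
          have := contraction_step hF hmono (fun t => a t + ∑ l : Fin m, sgn (ε l) * x l.succ t)
            (u 0) (x 0) (hu 0) (hux 0)
          simpa [add_right_comm, sub_eq_add_neg] using this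

end Contraction

lemma convexOn_posPart_pow (p : ℕ) : ConvexOn ℝ Set.univ fun x : ℝ => max x 0 ^ p := by
  have h : ConvexOn ℝ Set.univ fun x : ℝ => max x 0 :=
    (convexOn_id convex_univ).sup (convexOn_const 0 convex_univ)
  exact h.pow (fun _ _ => le_max_right _ _) p

lemma monotone_posPart_pow (p : ℕ) : Monotone fun x : ℝ => max x 0 ^ p :=
  fun _ _ h => pow_le_pow_left₀ (le_max_right _ _) (max_le_max_right 0 h) p

end EDMSampling

/-! ### Matrix Khintchine inequality for even trace moments -/

namespace EDMSampling

variable {n : ℕ}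

/-- Spectral decomposition of all powers of a real symmetric matrix. -/
lemma exists_diagonalization {B : Matrix (Fin n) (Fin n) ℝ} (hB : B.IsSymm) :
    ∃ (U : Matrix (Fin n) (Fin n) ℝ) (b : Fin n → ℝ), U * U.transpose = 1 ∧
      U.transpose * U = 1 ∧
      ∀ q : ℕ, B ^ q = U * Matrix.diagonal (fun i => b i ^ q) * U.transpose := by
  have hH : B.IsHermitian := by
    rw [Matrix.IsHermitian, Matrix.conjTranspose_eq_transpose_of_trivial]; exact hB
  set U : Matrix (Fin n) (Fin n) ℝ :=
    (hH.eigenvectorUnitary : Matrix (Fin n) (Fin n) ℝ) with hU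
  have hs : star U = U.transpose := by
    rw [Matrix.star_eq_conjTranspose, Matrix.conjTranspose_eq_transpose_of_trivial]
  have h1 : U * U.transpose = 1 := by
    rw [← hs]; exact Unitary.coe_mul_star_self hH.eigenvectorUnitary
  have h2 : U.transpose * U = 1 := by
    rw [← hs]; exact Unitary.coe_star_mul_self hH.eigenvectorUnitary
  refine ⟨U, hH.eigenvalues, h1, h2, fun q => ?_⟩
  have hB1 : B = U * Matrix.diagonal hH.eigenvalues * U.transpose := by
    conv_lhs => rw [hH.spectral_theorem, Unitary.conjStarAlgAut_apply]
    rw [← hs]; rfl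
  induction q with
  | zero => simp [h1]
  | succ q ih =>
    calc B ^ (q + 1) = U * Matrix.diagonal (fun i => hH.eigenvalues i ^ q) * U.transpose *
          (U * Matrix.diagonal hH.eigenvalues * U.transpose) := by rw [pow_succ, ih, ← hB1]
      _ = U * (Matrix.diagonal (fun i => hH.eigenvalues i ^ q) * ((U.transpose * U) *
            Matrix.diagonal hH.eigenvalues)) * U.transpose := by simp only [Matrix.mul_assoc]
      _ = _ := by rw [h2, Matrix.one_mul, Matrix.diagonal_mul_diagonal]; simp only [pow_succ]

/-- In eigenbases of `B` and `C`, with `W` the matrix of `X` between them, mixed traces become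
combinations of scalar monomials with nonnegative weights, so scalar inequalities transfer to
traces. -/
lemma exists_trace_mixed_powers {X B C : Matrix (Fin n) (Fin n) ℝ} (hX : X.IsSymm)
    (hB : B.IsSymm) (hC : C.IsSymm) :
    ∃ (W : Fin n → Fin n → ℝ) (b c : Fin n → ℝ), ∀ q r : ℕ,
      (X * B ^ q * X * C ^ r).trace = ∑ i, ∑ j, W i j ^ 2 * (b i ^ q * c j ^ r) := by
  obtain ⟨U, b, -, -, hU⟩ := exists_diagonalization hB
  obtain ⟨V, c, -, -, hV⟩ := exists_diagonalization hC
  refine ⟨fun i j => (U.transpose * X * V) i j, b, c, fun q r => ?_⟩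
  have hW : V.transpose * X * U = (U.transpose * X * V).transpose := by
    rw [Matrix.transpose_mul, Matrix.transpose_mul, Matrix.transpose_transpose, hX.eq,
      Matrix.mul_assoc]
  have h : (X * B ^ q * X * C ^ r).trace =
      ((U.transpose * X * V).transpose * Matrix.diagonal (fun i => b i ^ q) *
        (U.transpose * X * V) * Matrix.diagonal (fun j => c j ^ r)).trace := by
    rw [hU, hV, ← hW]
    calc _ = (X * U * Matrix.diagonal (fun i => b i ^ q) * U.transpose * X * V *
              Matrix.diagonal (fun j => c j ^ r) * V.transpose).trace := by
            simp only [Matrix.mul_assoc]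
      _ = _ := by rw [Matrix.trace_mul_comm]; simp only [Matrix.mul_assoc]
  rw [h, Matrix.trace]
  simp only [Matrix.diag, Matrix.mul_diagonal]
  rw [Finset.sum_comm]
  refine Finset.sum_congr rfl fun j _ => ?_
  rw [Matrix.mul_apply, Finset.sum_mul]
  refine Finset.sum_congr rfl fun i _ => ?_
  rw [Matrix.mul_diagonal, Matrix.transpose_apply]
  ring

/-- Rearrangement: |b|^q - |c|^q and |b|^r - |c|^r have the same sign. The total degree is even, so
the absolute values disappear at the end. -/
lemma pow_mul_pow_le_of_add_eq {b c : ℝ} (k q r : ℕ) (h : q + r = 2 * k) :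
    b ^ q * c ^ r + b ^ r * c ^ q ≤ b ^ (2 * k) + c ^ (2 * k) := by
  have h1 : b ^ q * c ^ r + b ^ r * c ^ q ≤ |b| ^ q * |c| ^ r + |b| ^ r * |c| ^ q := by
    refine (le_abs_self _).trans ((abs_add_le _ _).trans (le_of_eq ?_))
    simp [abs_mul, abs_pow]
  have h2 : |b| ^ q * |c| ^ r + |b| ^ r * |c| ^ q ≤ |b| ^ (q + r) + |c| ^ (q + r) := by
    have : 0 ≤ (|b| ^ q - |c| ^ q) * (|b| ^ r - |c| ^ r) := by
      rcases le_total |b| |c| with h | h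
      · exact mul_nonneg_of_nonpos_of_nonpos
          (sub_nonpos.2 (pow_le_pow_left₀ (abs_nonneg _) h _))
          (sub_nonpos.2 (pow_le_pow_left₀ (abs_nonneg _) h _))
      · exact mul_nonneg (sub_nonneg.2 (pow_le_pow_left₀ (abs_nonneg _) h _))
          (sub_nonneg.2 (pow_le_pow_left₀ (abs_nonneg _) h _))
    rw [pow_add, pow_add]
    linarith
  rw [h, pow_mul |b|, pow_mul |c|, sq_abs, sq_abs, ← pow_mul, ← pow_mul] at h2
  exact h1.trans h2

/-- The terms q and 2k - q are paired, and the scalar inequality is applied to each pair. -/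
lemma sum_trace_mixed_powers_le {X B C : Matrix (Fin n) (Fin n) ℝ} (hX : X.IsSymm)
    (hB : B.IsSymm) (hC : C.IsSymm) (k : ℕ) :
    ∑ q ∈ Finset.range (2 * k + 1), (X * B ^ q * X * C ^ (2 * k - q)).trace ≤
      (2 * k + 1) / 2 * ((X * X * B ^ (2 * k)).trace + (X * X * C ^ (2 * k)).trace) := by
  obtain ⟨W, b, c, h⟩ := exists_trace_mixed_powers hX hB hC
  have e1 : (X * X * B ^ (2 * k)).trace = ∑ i, ∑ j, W i j ^ 2 * b i ^ (2 * k) := by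
    have := h (2 * k) 0
    simp only [pow_zero, mul_one] at this
    rw [← this, Matrix.mul_assoc, Matrix.trace_mul_comm]
  have e2 : (X * X * C ^ (2 * k)).trace = ∑ i, ∑ j, W i j ^ 2 * c j ^ (2 * k) := by
    simpa using h 0 (2 * k)
  have e3 : ∑ q ∈ Finset.range (2 * k + 1), (X * B ^ q * X * C ^ (2 * k - q)).trace =
      ∑ q ∈ Finset.range (2 * k + 1), (X * B ^ (2 * k - q) * X * C ^ q).trace := by
    rw [← Finset.sum_range_reflect]
    refine Finset.sum_congr rfl fun q hq => ?_
    have : q ≤ 2 * k := Nat.lt_succ_iff.1 (Finset.mem_range.1 hq)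
    rw [show 2 * k + 1 - 1 - q = 2 * k - q by omega, show 2 * k - (2 * k - q) = q by omega]
  have key : ∀ q ∈ Finset.range (2 * k + 1), (X * B ^ q * X * C ^ (2 * k - q)).trace +
      (X * B ^ (2 * k - q) * X * C ^ q).trace ≤
        (X * X * B ^ (2 * k)).trace + (X * X * C ^ (2 * k)).trace := by
    intro q hq
    have hq' : q ≤ 2 * k := Nat.lt_succ_iff.1 (Finset.mem_range.1 hq)
    rw [h, h, e1, e2, ← Finset.sum_add_distrib, ← Finset.sum_add_distrib]
    refine Finset.sum_le_sum fun i _ => ?_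
    rw [← Finset.sum_add_distrib, ← Finset.sum_add_distrib]
    refine Finset.sum_le_sum fun j _ => ?_
    rw [← mul_add, ← mul_add]
    exact mul_le_mul_of_nonneg_left
      (pow_mul_pow_le_of_add_eq k q (2 * k - q) (by omega)) (sq_nonneg _)
  have := Finset.sum_le_sum key
  rw [Finset.sum_add_distrib, ← e3, Finset.sum_const, Finset.card_range, nsmul_eq_mul] at this
  push_cast at this
  linarith

lemma pow_sub_pow_eq_sum (Y Z : Matrix (Fin n) (Fin n) ℝ) (k : ℕ) :
    Y ^ (k + 1) - Z ^ (k + 1) =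
      ∑ q ∈ Finset.range (k + 1), Y ^ q * (Y - Z) * Z ^ (k - q) := by
  induction k with
  | zero => simp
  | succ k ih =>
    rw [Finset.sum_range_succ]
    have : ∑ q ∈ Finset.range (k + 1), Y ^ q * (Y - Z) * Z ^ (k + 1 - q) =
        (∑ q ∈ Finset.range (k + 1), Y ^ q * (Y - Z) * Z ^ (k - q)) * Z := by
      rw [Finset.sum_mul]
      refine Finset.sum_congr rfl fun q hq => ?_
      have : k + 1 - q = (k - q) + 1 := by have := Finset.mem_range.1 hq; omega
      rw [this, pow_succ Z (k - q), Matrix.mul_assoc, Matrix.mul_assoc, Matrix.mul_assoc]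
    rw [this, ← ih]
    simp only [Nat.sub_self, pow_zero, mul_one]
    rw [pow_succ Y (k + 1), pow_succ Z (k + 1)]
    noncomm_ring

variable {m : ℕ}

/-- The Rademacher sum `∑ ε_l M_l`. -/
noncomputable def rademacherSum (M : Fin m → Matrix (Fin n) (Fin n) ℝ) (ε : Fin m → Bool) :
    Matrix (Fin n) (Fin n) ℝ :=
  ∑ l, sgn (ε l) • M l

lemma isSymm_rademacherSum {M : Fin m → Matrix (Fin n) (Fin n) ℝ} (hM : ∀ l, (M l).IsSymm)
    (ε : Fin m → Bool) : (rademacherSum M ε).IsSymm := by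
  rw [Matrix.IsSymm, rademacherSum, Matrix.transpose_sum]
  exact Finset.sum_congr rfl fun l _ => by rw [Matrix.transpose_smul, (hM l).eq]

/-- Flip the sign at index `l`. -/
def flipAt (l : Fin m) (ε : Fin m → Bool) : Fin m → Bool := Function.update ε l (!ε l)

lemma flipAt_involutive (l : Fin m) : Function.Involutive (flipAt l) := by
  intro ε
  simp [flipAt]

lemma rademacherSum_sub_flipAt (M : Fin m → Matrix (Fin n) (Fin n) ℝ) (ε : Fin m → Bool)
    (l : Fin m) :
    rademacherSum M ε - rademacherSum M (flipAt l ε) = (2 * sgn (ε l)) • M l := by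
  rw [rademacherSum, rademacherSum, ← Finset.sum_sub_distrib,
    Finset.sum_eq_single l]
  · simp only [flipAt, Function.update_self, sgn_not, neg_smul, sub_neg_eq_add, two_mul, add_smul]
  · intro i _ hi
    simp [flipAt, Function.update_of_ne hi]
  · simp

lemma trace_diagonal_mul_even_pow_le {Y : Matrix (Fin n) (Fin n) ℝ} (hY : Y.IsSymm)
    {d : Fin n → ℝ} {s : ℝ} (hd : ∀ i, d i ≤ s) (k : ℕ) :
    (Matrix.diagonal d * Y ^ (2 * k)).trace ≤ s * (Y ^ (2 * k)).trace := by
  rw [Matrix.trace, Matrix.trace, Finset.mul_sum]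
  refine Finset.sum_le_sum fun i _ => ?_
  simp only [Matrix.diag, Matrix.diagonal_mul]
  refine mul_le_mul_of_nonneg_right (hd i) ?_
  have hk : (Y ^ k).IsSymm := by rw [Matrix.IsSymm, Matrix.transpose_pow, hY.eq]
  rw [two_mul, pow_add, Matrix.mul_apply]
  refine Finset.sum_nonneg fun j _ => ?_
  rw [hk.apply i j]
  exact mul_self_nonneg _

/-- Discrete integration by parts. One factor of the power is expanded, and flipping `ε l` turns its
coefficient into a difference of powers of two sums differing by `2 * sgn (ε l)` times `M l`.
Telescoping and the mixed trace bound leave 2k + 1 copies of the trace of `M l * M l * Y ε ^ (2 *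
k)`, and the sum over `l` produces the diagonal matrix. -/
lemma sum_trace_rademacherSum_pow_succ_le {M : Fin m → Matrix (Fin n) (Fin n) ℝ}
    (hM : ∀ l, (M l).IsSymm) {d : Fin n → ℝ} {s : ℝ}
    (hsum : ∑ l, M l * M l = Matrix.diagonal d) (hd : ∀ i, d i ≤ s) (k : ℕ) :
    ∑ ε, (rademacherSum M ε ^ (2 * (k + 1))).trace ≤
      (2 * k + 1) * s * ∑ ε, (rademacherSum M ε ^ (2 * k)).trace := by
  set Y := rademacherSum M with hYdef
  have hY := isSymm_rademacherSum hM
  have step1 : ∀ ε, (Y ε ^ (2 * (k + 1))).trace =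
      ∑ l, sgn (ε l) * (M l * Y ε ^ (2 * k + 1)).trace := by
    intro ε
    rw [show 2 * (k + 1) = (2 * k + 1) + 1 by ring, pow_succ']
    conv_lhs => rw [show Y ε * Y ε ^ (2 * k + 1) =
      (∑ l, sgn (ε l) • M l) * Y ε ^ (2 * k + 1) from rfl]
    rw [Finset.sum_mul, Matrix.trace_sum]
    exact Finset.sum_congr rfl fun l _ => by
      rw [Matrix.smul_mul, Matrix.trace_smul, smul_eq_mul]
  have step2 : ∀ l, ∑ ε : Fin m → Bool, sgn (ε l) * (M l * Y ε ^ (2 * k + 1)).trace ≤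
      (2 * k + 1) * ∑ ε, (M l * M l * Y ε ^ (2 * k)).trace := by
    intro l
    have hflip : ∀ g : (Fin m → Bool) → ℝ, ∑ ε, g (flipAt l ε) = ∑ ε, g ε := fun g =>
      Equiv.sum_comp (flipAt_involutive l).toPerm g
    have e1 : ∑ ε : Fin m → Bool, sgn (ε l) * (M l * Y ε ^ (2 * k + 1)).trace =
        ∑ ε : Fin m → Bool, (1 / 2) * (sgn (ε l) *
          (M l * (Y ε ^ (2 * k + 1) - Y (flipAt l ε) ^ (2 * k + 1))).trace) := by
      have h := hflip fun ε => sgn (ε l) * (M l * Y ε ^ (2 * k + 1)).trace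
      have h2 : ∑ ε : Fin m → Bool, sgn (flipAt l ε l) *
          (M l * Y (flipAt l ε) ^ (2 * k + 1)).trace =
          -∑ ε : Fin m → Bool, sgn (ε l) * (M l * Y (flipAt l ε) ^ (2 * k + 1)).trace := by
        rw [← Finset.sum_neg_distrib]
        exact Finset.sum_congr rfl fun ε _ => by
          simp [flipAt, sgn_not]
      simp only [Matrix.trace_sub, mul_sub, Finset.sum_sub_distrib,
        ← Finset.mul_sum]
      rw [h2] at h
      linarith
    have e2 : ∀ ε : Fin m → Bool, (1 / 2) * (sgn (ε l) *
          (M l * (Y ε ^ (2 * k + 1) - Y (flipAt l ε) ^ (2 * k + 1))).trace) ≤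
        (2 * k + 1) / 2 * ((M l * M l * Y ε ^ (2 * k)).trace +
          (M l * M l * Y (flipAt l ε) ^ (2 * k)).trace) := by
      intro ε
      refine le_of_eq_of_le ?_
        (sum_trace_mixed_powers_le (hM l) (hY ε) (hY (flipAt l ε)) k)
      rw [pow_sub_pow_eq_sum, Finset.mul_sum, Matrix.trace_sum, Finset.mul_sum, Finset.mul_sum]
      refine Finset.sum_congr rfl fun q _ => ?_
      rw [rademacherSum_sub_flipAt, Matrix.mul_smul, Matrix.smul_mul, Matrix.mul_smul,
        Matrix.trace_smul, smul_eq_mul]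
      simp only [Matrix.mul_assoc]
      linear_combination (M l * (Y ε ^ q * (M l * Y (flipAt l ε) ^ (2 * k - q)))).trace *
        sgn_mul_self (ε l)
    rw [e1]
    refine (Finset.sum_le_sum fun ε _ => e2 ε).trans (le_of_eq ?_)
    rw [← Finset.mul_sum, Finset.sum_add_distrib,
      hflip fun ε => (M l * M l * Y ε ^ (2 * k)).trace]
    ring
  calc ∑ ε, (Y ε ^ (2 * (k + 1))).trace
      = ∑ l, ∑ ε : Fin m → Bool, sgn (ε l) * (M l * Y ε ^ (2 * k + 1)).trace := by
        rw [Finset.sum_comm]; exact Finset.sum_congr rfl fun ε _ => step1 ε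
    _ ≤ ∑ l, (2 * k + 1) * ∑ ε, (M l * M l * Y ε ^ (2 * k)).trace :=
        Finset.sum_le_sum fun l _ => step2 l
    _ = (2 * k + 1) * ∑ ε, (Matrix.diagonal d * Y ε ^ (2 * k)).trace := by
        rw [← Finset.mul_sum, Finset.sum_comm]
        congr 1
        refine Finset.sum_congr rfl fun ε _ => ?_
        rw [← hsum, Finset.sum_mul, Matrix.trace_sum]
    _ ≤ (2 * k + 1) * ∑ ε, s * (Y ε ^ (2 * k)).trace := by
        refine mul_le_mul_of_nonneg_left (Finset.sum_le_sum fun ε _ => ?_) (by positivity)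
        exact trace_diagonal_mul_even_pow_le (hY ε) hd k
    _ = _ := by rw [← Finset.mul_sum]; ring

lemma trace_even_pow_nonneg {Y : Matrix (Fin n) (Fin n) ℝ} (hY : Y.IsSymm) (k : ℕ) :
    0 ≤ (Y ^ (2 * k)).trace := by
  have := trace_diagonal_mul_even_pow_le hY (d := fun _ => -1) (s := 0) (by norm_num) k
  have h1 : Matrix.diagonal (fun _ : Fin n => (-1 : ℝ)) = -1 := by
    ext i j
    by_cases h : i = j <;> simp [h]
  rw [h1] at this
  simpa using this

/-- A matrix Khintchine inequality: even trace moments of a Rademacher sum. -/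
theorem sum_trace_rademacherSum_pow_le {M : Fin m → Matrix (Fin n) (Fin n) ℝ}
    (hM : ∀ l, (M l).IsSymm) {d : Fin n → ℝ} {s : ℝ} (hs : 0 ≤ s)
    (hsum : ∑ l, M l * M l = Matrix.diagonal d) (hd : ∀ i, d i ≤ s) (p : ℕ) :
    ∑ ε, (rademacherSum M ε ^ (2 * p)).trace ≤ (2 * p * s) ^ p * (2 ^ m * n) := by
  -- Below `p` every recursion factor 2k + 1 is at most 2p, so one fixed factor serves the whole
  -- induction.
  suffices H : ∀ k ≤ p, ∑ ε, (rademacherSum M ε ^ (2 * k)).trace ≤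
      (2 * p * s) ^ k * (2 ^ m * n) from H p le_rfl
  intro k
  induction k with
  | zero => intro _; simp
  | succ k ih =>
    intro hk
    have h0 : 0 ≤ ∑ ε, (rademacherSum M ε ^ (2 * k)).trace :=
      Finset.sum_nonneg fun ε _ => trace_even_pow_nonneg (isSymm_rademacherSum hM ε) k
    have hk' : (k : ℝ) + 1 ≤ p := by exact_mod_cast hk
    calc _ ≤ (2 * k + 1) * s * ∑ ε, (rademacherSum M ε ^ (2 * k)).trace :=
          sum_trace_rademacherSum_pow_succ_le hM hsum hd k
      _ ≤ (2 * p * s) * ∑ ε, (rademacherSum M ε ^ (2 * k)).trace := by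
          refine mul_le_mul_of_nonneg_right (mul_le_mul_of_nonneg_right ?_ hs) h0
          linarith
      _ ≤ (2 * p * s) * ((2 * p * s) ^ k * (2 ^ m * n)) :=
          mul_le_mul_of_nonneg_left (ih (by omega)) (by positivity)
      _ = _ := by ring

end EDMSampling

/-! ### Operator norm and trace duality -/

namespace EDMSampling

variable {n : ℕ}

lemma norm_toEuclideanLin_le_of_diagonalization {Y U : Matrix (Fin n) (Fin n) ℝ} {b : Fin n → ℝ}
    {y : ℝ} (hY : Y.IsSymm) (hU : U * U.transpose = 1)
    (hpow : ∀ q : ℕ, Y ^ q = U * Matrix.diagonal (fun i => b i ^ q) * U.transpose)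
    (hy : 0 ≤ y) (hb : ∀ i, |b i| ≤ y) (v : EuclideanSpace ℝ (Fin n)) :
    ‖Matrix.toEuclideanLin Y v‖ ≤ y * ‖v‖ := by
  refine abs_le_of_sq_le_sq' ?_ (by positivity) |>.2
  set w : Fin n → ℝ := U.transpose.mulVec v.ofLp with hw
  have nv : ‖v‖ ^ 2 = dotProduct w w := by
    rw [EuclideanSpace.real_norm_sq_eq, hw, Matrix.dotProduct_mulVec, Matrix.vecMul_mulVec,
      Matrix.transpose_transpose, hU, Matrix.vecMul_one]
    simp [dotProduct, sq]
  have nY : ‖Matrix.toEuclideanLin Y v‖ ^ 2 = ∑ i, b i ^ 2 * w i ^ 2 := by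
    have h2 : Y.transpose * Y = U * Matrix.diagonal (fun i => b i ^ 2) * U.transpose := by
      rw [hY.eq, ← sq, hpow]
    have h3 : ‖Matrix.toEuclideanLin Y v‖ ^ 2 =
        dotProduct (Y.mulVec v.ofLp) (Y.mulVec v.ofLp) := by
      rw [EuclideanSpace.real_norm_sq_eq]
      simp [dotProduct, sq]
    rw [h3, Matrix.dotProduct_mulVec, Matrix.vecMul_mulVec, ← Matrix.dotProduct_mulVec, h2,
      ← Matrix.mulVec_mulVec, ← Matrix.mulVec_mulVec, Matrix.dotProduct_mulVec,
      ← Matrix.mulVec_transpose]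
    simp only [dotProduct, Matrix.mulVec_diagonal]
    exact Finset.sum_congr rfl fun i _ => by rw [← hw]; ring
  rw [mul_pow, nv, nY, dotProduct, Finset.mul_sum]
  refine Finset.sum_le_sum fun i _ => ?_
  rw [← sq]
  exact mul_le_mul_of_nonneg_right (sq_le_sq' (by linarith [abs_le.1 (hb i)])
    (abs_le.1 (hb i)).2) (sq_nonneg _)

/-- Trace duality with the nuclear norm, for any bound `y` on the Euclidean operator norm. -/
lemma traceInner_le_nuclearNorm_mul {A Y : Matrix (Fin n) (Fin n) ℝ} {y : ℝ}
    (hy : ∀ v, ‖Matrix.toEuclideanLin Y v‖ ≤ y * ‖v‖) :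
    traceInner Y A ≤ nuclearNorm A * y := by
  set T := Matrix.toEuclideanLin A with hT
  have hn : Module.finrank ℝ (EuclideanSpace ℝ (Fin n)) = n := by simp
  -- The trace is computed in a basis of right singular vectors, where `T` stretches each vector by
  -- its singular value.
  set e := T.isSymmetric_adjoint_comp_self.eigenvectorBasis hn with he
  have hnorm : ∀ i : Fin n, ‖T (e i)‖ = T.singularValues i := by
    intro i
    refine (sq_eq_sq₀ (norm_nonneg _) (T.singularValues_nonneg _)).1 ?_
    rw [T.sq_singularValues_fin hn, ← real_inner_self_eq_norm_sq, ← LinearMap.adjoint_inner_right]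
    have := T.isSymmetric_adjoint_comp_self.apply_eigenvectorBasis hn i
    rw [LinearMap.comp_apply] at this
    rw [he, this, inner_smul_right, real_inner_self_eq_norm_sq,
      (T.isSymmetric_adjoint_comp_self.eigenvectorBasis hn).orthonormal.1 i]
    simp
  have htr : traceInner Y A = LinearMap.trace ℝ _ (Matrix.toEuclideanLin Y ∘ₗ T) := by
    rw [traceInner, ← Matrix.trace_toLin_eq (Y * A) (EuclideanSpace.basisFun (Fin n) ℝ).toBasis,
      Matrix.toEuclideanLin_eq_toLin_orthonormal, hT, Matrix.toEuclideanLin_eq_toLin_orthonormal,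
      Matrix.toLin_mul _ (EuclideanSpace.basisFun (Fin n) ℝ).toBasis]
  rw [htr, LinearMap.trace_eq_sum_inner _ e, nuclearNorm, Finset.sum_mul, Finset.sum_range]
  refine Finset.sum_le_sum fun i _ => ?_
  calc _ ≤ ‖e i‖ * ‖Matrix.toEuclideanLin Y (T (e i))‖ := real_inner_le_norm _ _
    _ ≤ 1 * (y * ‖T (e i)‖) := by
        rw [e.orthonormal.1 i]; exact mul_le_mul_of_nonneg_left (hy _) zero_le_one
    _ = _ := by rw [hnorm]; ring

/-- The bound is the largest absolute eigenvalue; its even powers are single terms of the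
nonnegative eigenvalue sum giving the trace. -/
lemma exists_operator_bound (hn : 0 < n) {Y : Matrix (Fin n) (Fin n) ℝ} (hY : Y.IsSymm) :
    ∃ y : ℝ, 0 ≤ y ∧ (∀ p : ℕ, y ^ (2 * p) ≤ (Y ^ (2 * p)).trace) ∧
      ∀ A : Matrix (Fin n) (Fin n) ℝ, traceInner Y A ≤ nuclearNorm A * y := by
  have : Nonempty (Fin n) := ⟨⟨0, hn⟩⟩
  obtain ⟨U, b, hU, hU', hpow⟩ := exists_diagonalization hY
  obtain ⟨i, hi⟩ := Finite.exists_max fun i => |b i|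
  refine ⟨|b i|, abs_nonneg _, fun p => ?_, fun A => traceInner_le_nuclearNorm_mul
    (norm_toEuclideanLin_le_of_diagonalization hY hU hpow (abs_nonneg _) hi)⟩
  rw [hpow, Matrix.trace_mul_comm, ← Matrix.mul_assoc, hU', Matrix.one_mul,
    Matrix.trace_diagonal, pow_mul, sq_abs, ← pow_mul]
  exact Finset.single_le_sum (f := fun i => b i ^ (2 * p))
    (fun j _ => by rw [pow_mul]; positivity) (Finset.mem_univ i)

end EDMSampling

/-! ### Chernoff bounds and symmetrization by counting -/

namespace EDMSampling

/-- Exchange two samples at the indices with negative sign. -/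
def exchange {V : Type*} {m : ℕ} (ε : Fin m → Bool) (x : (Fin m → V) × (Fin m → V)) : (Fin m → V) × (Fin m → V) :=
  (fun l => if ε l then x.1 l else x.2 l, fun l => if ε l then x.2 l else x.1 l)

lemma exchange_involutive {V : Type*} {m : ℕ} (ε : Fin m → Bool) :
    Function.Involutive (exchange (V := V) ε) := by
  intro x
  refine Prod.ext (funext fun l => ?_) (funext fun l => ?_) <;>
    cases h : ε l <;> simp [exchange, h]

section Counting

variable {V : Type*} [Fintype V] {m : ℕ}

lemma sum_exp_sum_eq (h : V → ℝ) :
    ∑ w : Fin m → V, Real.exp (∑ l, h (w l)) = (∑ v, Real.exp (h v)) ^ m := by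
  classical
  simp_rw [Real.exp_sum]
  rw [Fintype.sum_pow]

/-- (1 - x + x²/2)(1 + x + x²/2) = 1 + x⁴/4 ≥ 1. -/
lemma exp_neg_le_quadratic {x : ℝ} (hx : 0 ≤ x) : Real.exp (-x) ≤ 1 - x + x ^ 2 / 2 := by
  have h := Real.quadratic_le_exp_of_nonneg hx
  rw [Real.exp_neg, inv_le_iff_one_le_mul₀ (Real.exp_pos x)]
  have h0 : 0 ≤ 1 - x + x ^ 2 / 2 := by nlinarith [sq_nonneg (x - 1)]
  nlinarith [mul_le_mul_of_nonneg_left h h0, sq_nonneg (x ^ 2)]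

open Classical in
/-- Chernoff lower tail for a sum of independent uniform samples of a `[0, 1/2]`-valued function. -/
lemma lower_tail_count (f : V → ℝ) (h0 : ∀ v, 0 ≤ f v) (h1 : ∀ v, f v ≤ 1 / 2) {μ : ℝ}
    (hμ : ∑ v, f v = Fintype.card V * μ) (hm : 16 ≤ m * μ) :
    ∑ w : Fin m → V, (if ∑ l, f (w l) < 3 / 4 * (m * μ) then (1 : ℝ) else 0) ≤
      (Fintype.card V : ℝ) ^ m / 2 := by
  set N : ℝ := (Fintype.card V : ℝ)
  have step : ∀ w : Fin m → V, (if ∑ l, f (w l) < 3 / 4 * (m * μ) then (1 : ℝ) else 0) ≤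
      Real.exp (3 / 8 * (m * μ)) * Real.exp (∑ l, -(f (w l) / 2)) := by
    intro w
    rw [← Real.exp_add]
    split_ifs with h
    · rw [Finset.sum_neg_distrib, ← Finset.sum_div]
      exact Real.one_le_exp (by linarith)
    · exact (Real.exp_pos _).le
  -- From f ≤ 1/2, 1 - f/2 + f²/8 ≤ 1 - 7f/16. Against the Markov factor 3/8 this leaves the
  -- exponent -mμ/16 ≤ -1.
  have base : ∑ v, Real.exp (-(f v / 2)) ≤ N * Real.exp (-(7 / 16 * μ)) := by
    calc ∑ v, Real.exp (-(f v / 2)) ≤ ∑ v, (1 - 7 / 16 * f v) := by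
          refine Finset.sum_le_sum fun v _ => ?_
          have := exp_neg_le_quadratic (x := f v / 2) (by linarith [h0 v])
          nlinarith [h0 v, h1 v, mul_nonneg (h0 v) (sub_nonneg.2 (h1 v))]
      _ = N * (1 - 7 / 16 * μ) := by
          rw [Finset.sum_sub_distrib, ← Finset.mul_sum, hμ]
          simp only [Finset.sum_const, Finset.card_univ, nsmul_eq_mul, mul_one, N]
          ring
      _ ≤ _ := by
          refine mul_le_mul_of_nonneg_left ?_ (Nat.cast_nonneg _)
          linarith [Real.add_one_le_exp (-(7 / 16 * μ))]
  calc _ ≤ ∑ w : Fin m → V, Real.exp (3 / 8 * (m * μ)) * Real.exp (∑ l, -(f (w l) / 2)) :=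
        Finset.sum_le_sum fun w _ => step w
    _ = Real.exp (3 / 8 * (m * μ)) * (∑ v, Real.exp (-(f v / 2))) ^ m := by
        rw [← Finset.mul_sum, sum_exp_sum_eq fun v => -(f v / 2)]
    _ ≤ Real.exp (3 / 8 * (m * μ)) * (N * Real.exp (-(7 / 16 * μ))) ^ m := by
        gcongr
    _ = N ^ m * Real.exp (-(m * μ / 16)) := by
        rw [mul_pow, ← Real.exp_nat_mul, mul_left_comm, ← Real.exp_add]
        congr 2; ring
    _ ≤ N ^ m * (1 / 2) := by
        refine mul_le_mul_of_nonneg_left ?_ (by positivity)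
        calc Real.exp (-(m * μ / 16)) ≤ Real.exp (-1) := Real.exp_le_exp.2 (by linarith)
          _ ≤ 1 / 2 := by
            rw [Real.exp_neg, one_div]
            exact inv_anti₀ (by norm_num) (by linarith [Real.add_one_le_exp 1])
    _ = _ := by ring

open Classical in
/-- Chernoff upper tail for the number of independent uniform samples falling in a set. -/
lemma upper_tail_count (E : V → Prop) [DecidablePred E] {ρ t : ℝ}
    (hρ : ∑ v, (if E v then (1 : ℝ) else 0) = Fintype.card V * ρ) :
    ∑ w : Fin m → V,
        (if t < ∑ l, (if E (w l) then (1 : ℝ) else 0) then (1 : ℝ) else 0) ≤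
      (Fintype.card V : ℝ) ^ m * Real.exp (2 * (m * ρ) - t) := by
  set N : ℝ := (Fintype.card V : ℝ)
  set h : V → ℝ := fun v => if E v then (1 : ℝ) else 0
  have step : ∀ w : Fin m → V, (if t < ∑ l, h (w l) then (1 : ℝ) else 0) ≤
      Real.exp (-t) * Real.exp (∑ l, h (w l)) := by
    intro w
    rw [← Real.exp_add]
    split_ifs with h
    · exact Real.one_le_exp (by linarith)
    · exact (Real.exp_pos _).le
  have base : ∑ v, Real.exp (h v) ≤ N * Real.exp (2 * ρ) := by
    calc ∑ v, Real.exp (h v) ≤ ∑ v, (1 + 2 * h v) := by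
          refine Finset.sum_le_sum fun v _ => ?_
          by_cases hv : E v
          · simp only [h, hv, if_true]; linarith [Real.exp_one_lt_d9]
          · simp [h, hv]
      _ = N * (1 + 2 * ρ) := by
          rw [Finset.sum_add_distrib, ← Finset.mul_sum, hρ]
          simp only [Finset.sum_const, Finset.card_univ, nsmul_eq_mul, mul_one, N]
          ring
      _ ≤ _ := by
          refine mul_le_mul_of_nonneg_left ?_ (Nat.cast_nonneg _)
          linarith [Real.add_one_le_exp (2 * ρ)]
  calc _ ≤ ∑ w : Fin m → V, Real.exp (-t) * Real.exp (∑ l, h (w l)) :=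
        Finset.sum_le_sum fun w _ => step w
    _ = Real.exp (-t) * (∑ v, Real.exp (h v)) ^ m := by
        rw [← Finset.mul_sum, sum_exp_sum_eq h]
    _ ≤ Real.exp (-t) * (N * Real.exp (2 * ρ)) ^ m := by gcongr
    _ = _ := by
        rw [mul_pow, ← Real.exp_nat_mul, mul_left_comm, ← Real.exp_add]
        congr 2; ring

open Classical in
/-- Symmetrization for one-sided deviations of an empirical process, in counting form. -/
lemma symmetrization_count [Nonempty V] {ι : Type*} (f : ι → V → ℝ) (lo hi : ι → ℝ)
    (htail : ∀ i, ∑ w : Fin m → V, (if ∑ l, f i (w l) < hi i then (1 : ℝ) else 0) ≤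
      (Fintype.card V : ℝ) ^ m / 2) :
    (∑ w : Fin m → V, (if ∃ i, ∑ l, f i (w l) < lo i then (1 : ℝ) else 0)) * 2 ^ m ≤
      4 * ∑ w : Fin m → V, ∑ ε : Fin m → Bool,
        (if ∃ i, (hi i - lo i) / 2 ≤ ∑ l, sgn (ε l) * f i (w l) then (1 : ℝ) else 0) := by
  set N : ℝ := (Fintype.card V : ℝ)
  have hN : 0 < N ^ m := by
    have : 0 < N := Nat.cast_pos.2 Fintype.card_pos
    positivity
  have hcard : ∑ _w : Fin m → V, (1 : ℝ) = N ^ m := by simp [N]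
  set b : (Fin m → V) → ℝ := fun w => if ∃ i, ∑ l, f i (w l) < lo i then 1 else 0 with hb
  set P : (Fin m → Bool) → (Fin m → V) → ℝ := fun ε w =>
    if ∃ i, (hi i - lo i) / 2 ≤ ∑ l, sgn (ε l) * f i (w l) then 1 else 0 with hP
  set Q : (Fin m → Bool) → (Fin m → V) × (Fin m → V) → ℝ := fun ε x =>
    if ∃ i, hi i - lo i ≤ ∑ l, sgn (ε l) * (f i (x.2 l) - f i (x.1 l)) then 1 else 0 with hQ
  have hP0 : ∀ ε w, 0 ≤ P ε w := fun ε w => by simp only [hP]; positivity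
  have hQ0 : ∀ ε w, 0 ≤ Q ε w := fun ε w => by simp only [hQ]; positivity
  -- For a bad `w` a witness `i` is fixed before the second sample is drawn; at least half of the
  -- second samples reach `hi i`.
  have ghost : ∀ w, b w * (N ^ m / 2) ≤ ∑ w', Q (fun _ => true) (w, w') := by
    intro w
    by_cases hw : ∃ i, ∑ l, f i (w l) < lo i
    · obtain ⟨i, hi'⟩ := hw
      have hle : ∀ w', 1 - (if ∑ l, f i (w' l) < hi i then (1 : ℝ) else 0) ≤
          Q (fun _ => true) (w, w') := by
        intro w'
        split_ifs with h
        · simpa using hQ0 _ _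
        · have : ∃ i, hi i - lo i ≤
              ∑ l, sgn ((fun _ => true : Fin m → Bool) l) * (f i (w' l) - f i (w l)) := by
            refine ⟨i, ?_⟩
            simp only [sgn_true, one_mul, Finset.sum_sub_distrib]
            linarith
          simp only [hQ, if_pos this, sub_zero, le_refl]
      have := Finset.sum_le_sum fun w' (_ : w' ∈ Finset.univ) => hle w'
      rw [Finset.sum_sub_distrib, hcard] at this
      have hb1 : b w = 1 := if_pos ⟨i, hi'⟩
      rw [hb1]
      linarith [htail i]
    · have hb1 : b w = 0 := if_neg hw
      rw [hb1, zero_mul]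
      exact Finset.sum_nonneg fun w' _ => hQ0 _ _
  have swap : ∀ ε, ∑ x, Q ε x = ∑ x, Q (fun _ => true) x := by
    intro ε
    rw [← Equiv.sum_comp (exchange_involutive ε).toPerm]
    refine Finset.sum_congr rfl fun x _ => ?_
    have : ∀ i l, sgn (ε l) * (f i ((exchange ε x).2 l) - f i ((exchange ε x).1 l)) =
        sgn true * (f i (x.2 l) - f i (x.1 l)) := by
      intro i l
      cases h : ε l <;> simp [exchange, h]
    simp only [hQ, Function.Involutive.coe_toPerm, this]
  -- If a difference is at least hi - lo, then one of its halves carries at least half of it; the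
  -- half from the first sample appears with reversed signs.
  have decouple : ∀ ε x, Q ε x ≤ P ε x.2 + P (fun l => !ε l) x.1 := by
    intro ε x
    by_cases h : ∃ i, hi i - lo i ≤ ∑ l, sgn (ε l) * (f i (x.2 l) - f i (x.1 l))
    · have hQ1 : Q ε x = 1 := if_pos h
      rw [hQ1]
      obtain ⟨i, hi'⟩ := h
      simp only [mul_sub, Finset.sum_sub_distrib] at hi'
      by_cases h2 : (hi i - lo i) / 2 ≤ ∑ l, sgn (ε l) * f i (x.2 l)
      · have : P ε x.2 = 1 := if_pos ⟨i, h2⟩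
        linarith [hP0 (fun l => !ε l) x.1]
      · have : P (fun l => !ε l) x.1 = 1 := if_pos ⟨i, by
          simp only [sgn_not, neg_mul, Finset.sum_neg_distrib]; linarith⟩
        linarith [hP0 ε x.2]
    · have hQ1 : Q ε x = 0 := if_neg h
      rw [hQ1]
      exact add_nonneg (hP0 _ _) (hP0 _ _)
  have hneg : Function.Involutive fun (ε : Fin m → Bool) l => !ε l := fun ε => by simp
  have hsumQ : ∀ ε, ∑ x, Q ε x ≤ N ^ m * (∑ w, P ε w + ∑ w, P (fun l => !ε l) w) := by
    intro ε
    refine (Finset.sum_le_sum fun x _ => decouple ε x).trans (le_of_eq ?_)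
    rw [Fintype.sum_prod_type]
    simp only [Finset.sum_add_distrib]
    rw [Finset.sum_comm]
    simp only [Finset.sum_const, Finset.card_univ, Fintype.card_pi, Finset.prod_const,
      Fintype.card_fin, nsmul_eq_mul, Nat.cast_pow, ← Finset.mul_sum]
    ring
  have h1 : (∑ w, b w) * (N ^ m / 2) ≤ ∑ x, Q (fun _ => true) x := by
    rw [Finset.sum_mul, Fintype.sum_prod_type]
    exact Finset.sum_le_sum fun w _ => ghost w
  have h2 : 2 ^ m * ∑ x, Q (fun _ => true) x ≤ N ^ m * (2 * ∑ w, ∑ ε, P ε w) := by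
    calc 2 ^ m * ∑ x, Q (fun _ => true) x = ∑ ε : Fin m → Bool, ∑ x, Q ε x := by
          simp only [swap]; simp
      _ ≤ ∑ ε : Fin m → Bool, N ^ m * (∑ w, P ε w + ∑ w, P (fun l => !ε l) w) :=
          Finset.sum_le_sum fun ε _ => hsumQ ε
      _ = _ := by
          have e : ∑ ε : Fin m → Bool, ∑ w, P (fun l => !ε l) w = ∑ ε, ∑ w, P ε w :=
            Equiv.sum_comp hneg.toPerm fun ε => ∑ w, P ε w
          rw [← Finset.mul_sum, Finset.sum_add_distrib, e, Finset.sum_comm]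
          ring
  refine le_of_mul_le_mul_left ?_ hN
  have := mul_le_mul_of_nonneg_left h1 (by positivity : (0 : ℝ) ≤ 2 ^ m)
  nlinarith

end Counting

end EDMSampling

/-! ### Sampling matrices and the conditional bound given the samples -/

namespace EDMSampling

variable {n : ℕ}

instance matrixMeasurableSingletonClass (n : ℕ) :
    MeasurableSingletonClass (Matrix (Fin n) (Fin n) ℝ) :=
  inferInstanceAs (MeasurableSingletonClass (Fin n → Fin n → ℝ))

lemma traceInner_comm (A B : Matrix (Fin n) (Fin n) ℝ) : traceInner A B = traceInner B A :=
  Matrix.trace_mul_comm A B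

lemma traceInner_basisMatrix {A : Matrix (Fin n) (Fin n) ℝ} (hA : A.IsSymm)
    (p : Fin n × Fin n) : traceInner A (basisMatrix p) = A p.1 p.2 := by
  rw [traceInner, basisMatrix, Matrix.mul_smul, Matrix.trace_smul, Matrix.mul_add,
    Matrix.trace_add, Matrix.trace_mul_single, Matrix.trace_mul_single, hA.apply p.1 p.2]
  simp only [smul_eq_mul, MulOpposite.op_one, one_smul]
  ring

lemma isSymm_basisMatrix (p : Fin n × Fin n) : (basisMatrix p).IsSymm := by
  rw [Matrix.IsSymm, basisMatrix, Matrix.transpose_smul, Matrix.transpose_add,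
    Matrix.transpose_single, Matrix.transpose_single, add_comm]

/-- Diagonal squares make the variance matrix in the Khintchine inequality a vector of sampled
degrees. -/
lemma basisMatrix_mul_self {p : Fin n × Fin n} (hp : p ∈ pairs n) :
    basisMatrix p * basisMatrix p =
      Matrix.diagonal fun i => 1 / 4 * (if i = p.1 ∨ i = p.2 then (1 : ℝ) else 0) := by
  have hlt : p.1 < p.2 := (Finset.mem_filter.1 hp).2
  have hne : p.1 ≠ p.2 := hlt.ne
  rw [basisMatrix, Matrix.smul_mul, Matrix.mul_smul, Matrix.add_mul, Matrix.mul_add,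
    Matrix.mul_add, Matrix.single_mul_single_same, Matrix.single_mul_single_same,
    Matrix.single_mul_single_of_ne _ _ _ _ hne.symm, Matrix.single_mul_single_of_ne _ _ _ _ hne]
  ext i j
  by_cases hij : i = j
  · subst hij
    by_cases h1 : i = p.1
    · subst h1
      simp [hne.symm]; norm_num
    · by_cases h2 : i = p.2
      · subst h2
        simp [hne]; norm_num
      · simp [h1, h2, Ne.symm h1, Ne.symm h2]
  · have h1 : ∀ a, ¬ (a = i ∧ a = j) := fun a h => hij (h.1.symm.trans h.2)
    simp [hij, h1]

lemma sum_pairs_incidence (i : Fin n) :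
    ∑ p ∈ pairs n, (if i = p.1 ∨ i = p.2 then (1 : ℝ) else 0) = n - 1 := by
  have e : ∀ p ∈ pairs n, (if i = p.1 ∨ i = p.2 then (1 : ℝ) else 0) =
      (if i = p.1 then 1 else 0) + (if i = p.2 then 1 else 0) := by
    intro p hp
    have hlt : p.1 < p.2 := (Finset.mem_filter.1 hp).2
    by_cases h1 : i = p.1
    · have : i ≠ p.2 := by rw [h1]; exact hlt.ne
      simp [h1, hlt.ne]
    · simp [h1]
  rw [Finset.sum_congr rfl e, pairs, Finset.sum_filter, Fintype.sum_prod_type]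
  have e2 : ∀ a b : Fin n, (if a < b then (if i = a then (1 : ℝ) else 0) +
      (if i = b then 1 else 0) else 0) =
      (if i = a then (if i < b then 1 else 0) else 0) +
        (if i = b then (if a < i then 1 else 0) else 0) := by
    intro a b
    by_cases h1 : i = a <;> by_cases h2 : i = b <;> simp [h1, h2] <;> aesop
  simp only [e2, Finset.sum_add_distrib]
  rw [Finset.sum_comm]
  simp only [Finset.sum_ite_eq, Finset.mem_univ, if_true]
  rw [← Finset.sum_add_distrib]
  have e3 : ∀ b : Fin n, (if i < b then (1 : ℝ) else 0) + (if b < i then 1 else 0) =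
      1 - (if i = b then 1 else 0) := by
    intro b
    rcases lt_trichotomy i b with h | h | h
    · simp [h, h.ne, h.not_gt]
    · simp [h]
    · simp [h, h.ne', h.not_gt]
  rw [Finset.sum_congr rfl fun b _ => e3 b, Finset.sum_sub_distrib]
  simp

lemma two_mul_card_pairs (n : ℕ) : 2 * ((pairs n).card : ℝ) = n * (n - 1) := by
  have h := Finset.sum_congr rfl fun i (_ : i ∈ (Finset.univ : Finset (Fin n))) =>
    sum_pairs_incidence i
  rw [Finset.sum_comm] at h
  have e : ∀ p ∈ pairs n, ∑ i : Fin n, (if i = p.1 ∨ i = p.2 then (1 : ℝ) else 0) = 2 := by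
    intro p hp
    have hlt : p.1 < p.2 := (Finset.mem_filter.1 hp).2
    have : ∀ i : Fin n, (if i = p.1 ∨ i = p.2 then (1 : ℝ) else 0) =
        (if i = p.1 then 1 else 0) + (if i = p.2 then 1 else 0) := by
      intro i
      by_cases h1 : i = p.1
      · simp [h1, hlt.ne]
      · simp [h1]
    rw [Finset.sum_congr rfl fun i _ => this i, Finset.sum_add_distrib]
    simp; norm_num
  rw [Finset.sum_congr rfl e] at h
  simp only [Finset.sum_const, nsmul_eq_mul, Finset.card_univ, Fintype.card_fin] at h
  linarith

lemma card_pairs_pos (hn : 2 ≤ n) : 0 < ((pairs n).card : ℝ) := by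
  have h := two_mul_card_pairs n
  have : (2 : ℝ) ≤ n := by exact_mod_cast hn
  nlinarith

lemma sum_pairs_incidence_eq (hn : 2 ≤ n) (i : Fin n) :
    ∑ v : pairs n, (if i = v.1.1 ∨ i = v.1.2 then (1 : ℝ) else 0) =
      Fintype.card (pairs n) * (2 / n) := by
  have hn' : (n : ℝ) ≠ 0 := by positivity
  rw [Finset.sum_coe_sort (pairs n) fun p => (if i = p.1 ∨ i = p.2 then (1 : ℝ) else 0),
    sum_pairs_incidence, Fintype.card_coe]
  field_simp
  linarith [two_mul_card_pairs n]

lemma secondMoment_eq {A : Matrix (Fin n) (Fin n) ℝ} (hA : A.IsSymm) :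
    secondMoment A = ((pairs n).card : ℝ)⁻¹ * ∑ p ∈ pairs n, A p.1 p.2 ^ 2 := by
  rw [secondMoment, uniformLaw, integral_smul_measure, integral_finsetSum_measure]
  · simp only [integral_dirac, traceInner_basisMatrix hA, smul_eq_mul]
    simp
  · exact fun p _ => integrable_dirac (by simp)

lemma sum_sq_eq_card_mul_secondMoment (hn : 2 ≤ n) {A : Matrix (Fin n) (Fin n) ℝ}
    (hA : A.IsSymm) :
    ∑ v : pairs n, A v.1.1 v.1.2 ^ 2 = Fintype.card (pairs n) * secondMoment A := by
  rw [Finset.sum_coe_sort (pairs n) fun p => A p.1 p.2 ^ 2, secondMoment_eq hA, Fintype.card_coe,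
    mul_inv_cancel_left₀ (card_pairs_pos hn).ne']

lemma frobNorm_sq_eq (hn : 2 ≤ n) {A : Matrix (Fin n) (Fin n) ℝ} (hA : A.IsSymm)
    (hdiag : ∀ i, A i i = 0) :
    frobNorm A ^ 2 = 2 * (pairs n).card * secondMoment A := by
  have h1 : traceInner A A = ∑ i, ∑ j, A i j ^ 2 := by
    rw [traceInner, Matrix.trace]
    refine Finset.sum_congr rfl fun i _ => ?_
    rw [Matrix.diag, Matrix.mul_apply]
    exact Finset.sum_congr rfl fun j _ => by rw [hA.apply i j, sq]
  have h0 : 0 ≤ traceInner A A := by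
    rw [h1]; positivity
  rw [frobNorm, Real.sq_sqrt h0, h1, secondMoment_eq hA, mul_assoc,
    mul_inv_cancel_left₀ (card_pairs_pos hn).ne', pairs, Finset.sum_filter, Fintype.sum_prod_type,
    two_mul]
  conv_rhs => arg 2; rw [Finset.sum_comm]
  rw [← Finset.sum_add_distrib]
  refine Finset.sum_congr rfl fun i _ => ?_
  rw [← Finset.sum_add_distrib]
  refine Finset.sum_congr rfl fun j _ => ?_
  rcases lt_trichotomy i j with h | h | h
  · simp [h, h.not_gt]
  · simp [h, hdiag]
  · simp [h, h.not_gt, hA.apply i j]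

lemma abs_apply_le_maxNorm (A : Matrix (Fin n) (Fin n) ℝ) (i j : Fin n) :
    |A i j| ≤ maxNorm A :=
  le_ciSup (f := fun p : Fin n × Fin n => |A p.1 p.2|) (Set.finite_range _).bddAbove (i, j)

/-- On [-1/√2, 1/√2] squaring is √2-Lipschitz, because |x + y| ≤ √2. -/
lemma sq_contraction {x y : ℝ} (hx : |x| ≤ 1 / √2) (hy : |y| ≤ 1 / √2) :
    |x ^ 2| ≤ |√2 * x| ∧ |x ^ 2 - y ^ 2| ≤ |√2 * x - √2 * y| := by
  have hs : √2 * √2 = 2 := Real.mul_self_sqrt (by norm_num)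
  have hs0 : 0 < √2 := by positivity
  have h1 : 2 * (1 / √2) = √2 := by
    field_simp; linarith
  constructor
  · rw [abs_mul, abs_of_pos hs0, sq, abs_mul]
    exact mul_le_mul_of_nonneg_right (by linarith [abs_nonneg x]) (abs_nonneg x)
  · rw [← mul_sub, abs_mul, abs_of_pos hs0, sq_sub_sq, abs_mul]
    exact mul_le_mul_of_nonneg_right ((abs_add_le _ _).trans (by linarith)) (abs_nonneg _)

variable {m : ℕ}

lemma sum_sign_apply_eq {A : Matrix (Fin n) (Fin n) ℝ} (hA : A.IsSymm) (w : Fin m → pairs n)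
    (ε : Fin m → Bool) :
    ∑ l, sgn (ε l) * A (w l).1.1 (w l).1.2 =
      traceInner (rademacherSum (fun l => basisMatrix (w l).1) ε) A := by
  rw [traceInner_comm, traceInner, rademacherSum, Finset.mul_sum, Matrix.trace_sum]
  refine Finset.sum_congr rfl fun l _ => ?_
  rw [Matrix.mul_smul, Matrix.trace_smul, smul_eq_mul]
  congr 1
  exact (traceInner_basisMatrix hA _).symm

/-- With E expressed through a², this is completing the square in `a`: the quadratic term of the
offset absorbs the linear term. -/
lemma offset_bound {μ ω τ a y E T : ℝ} (hμ : 0 < μ) (hω : 0 < ω) (hτ : 0 < τ)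
    (hE : a ^ 2 = 2 * ω * E) (hT : T ≤ √τ * a * y) :
    -(μ / 8 * E) + √2 * T ≤ 8 * τ * ω / μ * y ^ 2 := by
  have h1 : √2 * T ≤ √2 * (√τ * a * y) := mul_le_mul_of_nonneg_left hT (by positivity)
  have h2 : E = a ^ 2 / (2 * ω) := by rw [hE]; field_simp
  set c : ℝ := μ / (16 * ω) with hc
  have hc0 : 0 < c := by positivity
  have h3 : μ / 8 * E = c * a ^ 2 := by rw [h2, hc]; field_simp; ring
  have h4 : 8 * τ * ω / μ * y ^ 2 = (√2 * √τ * y) ^ 2 / (4 * c) := by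
    rw [mul_pow, mul_pow, Real.sq_sqrt hτ.le, Real.sq_sqrt (by norm_num), hc]
    field_simp; ring
  rw [h3, h4, le_div_iff₀ (by positivity)]
  nlinarith [sq_nonneg (√2 * √τ * y - 2 * c * a), mul_le_mul_of_nonneg_right h1 hc0.le]

open Classical in
/-- Conditional Rademacher bound: for samples whose incidence counts are at most `4 s`, few sign
patterns make the symmetrized process large. -/
lemma sign_count_le (hn : 2 ≤ n) (hm : 0 < m) {τ s R : ℝ} (hτ : 0 < τ) (hs : 0 ≤ s) (hR : 0 ≤ R)
    (w : Fin m → pairs n)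
    (hw : ∀ i : Fin n,
      ∑ l, (if i = (w l).1.1 ∨ i = (w l).1.2 then (1 : ℝ) else 0) ≤ 4 * s)
    (p : ℕ) :
    (m * R / 2) ^ p * ∑ ε : Fin m → Bool, (if ∃ A : coneSet n m τ,
        m * (secondMoment A.1 / 4 + R) / 2 ≤
          ∑ l, sgn (ε l) * A.1 (w l).1.1 (w l).1.2 ^ 2 then (1 : ℝ) else 0) ≤
      (8 * τ * (pairs n).card / m) ^ p * ((2 * p * s) ^ p * (2 ^ m * n)) := by
  have hm' : (0 : ℝ) < m := Nat.cast_pos.2 hm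
  have hΩ := card_pairs_pos hn
  set bad : (Fin m → Bool) → Prop := fun ε => ∃ A : coneSet n m τ,
    m * (secondMoment A.1 / 4 + R) / 2 ≤
      ∑ l, sgn (ε l) * A.1 (w l).1.1 (w l).1.2 ^ 2 with hbad
  by_cases hne : ∃ ε, bad ε
  swap
  · have h0 : ∀ ε, ¬ bad ε := fun ε h => hne ⟨ε, h⟩
    rw [Finset.sum_eq_zero fun ε _ => if_neg (h0 ε), mul_zero]
    positivity
  have hI : Nonempty {ε // bad ε} := nonempty_subtype.2 hne
  -- `contraction` needs a finite nonempty index type, so one witness is chosen for each bad sign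
  -- pattern; only these are needed for the lower bound.
  let S : {ε // bad ε} → Matrix (Fin n) (Fin n) ℝ := fun t => (Classical.choose t.2).1
  have hS : ∀ t, S t ∈ coneSet n m τ := fun t => (Classical.choose t.2).2
  have hSbad : ∀ t : {ε // bad ε}, m * (secondMoment (S t) / 4 + R) / 2 ≤
      ∑ l, sgn (t.1 l) * S t (w l).1.1 (w l).1.2 ^ 2 := fun t => Classical.choose_spec t.2
  set a : {ε // bad ε} → ℝ := fun t => -(m / 8 * secondMoment (S t)) with ha
  set F : ℝ → ℝ := fun x => max x 0 ^ p with hF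
  have hF0 : ∀ x, 0 ≤ F x := fun x => pow_nonneg (le_max_right _ _) _
  have hentry : ∀ t i j, |S t i j| ≤ 1 / √2 := fun t i j =>
    (abs_apply_le_maxNorm _ i j).trans (hS t).2.2.1.le
  set M : Fin m → Matrix (Fin n) (Fin n) ℝ := fun l => basisMatrix (w l).1 with hM
  have hMs : ∀ l, (M l).IsSymm := fun l => isSymm_basisMatrix _
  have lower : (m * R / 2) ^ p * ∑ ε : Fin m → Bool, (if bad ε then (1 : ℝ) else 0) ≤
      ∑ ε : Fin m → Bool,
        F (⨆ t, (a t + ∑ l, sgn (ε l) * S t (w l).1.1 (w l).1.2 ^ 2)) := by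
    rw [Finset.mul_sum]
    refine Finset.sum_le_sum fun ε _ => ?_
    split_ifs with h
    · rw [mul_one]
      refine pow_le_pow_left₀ (by positivity) (le_max_of_le_left ?_) _
      refine le_trans ?_ (le_ciSup (f := fun t => a t +
        ∑ l, sgn (ε l) * S t (w l).1.1 (w l).1.2 ^ 2) (Set.finite_range _).bddAbove ⟨ε, h⟩)
      have := hSbad ⟨ε, h⟩
      simp only [ha]
      linarith
    · rw [mul_zero]; exact hF0 _
  have contr := contraction (convexOn_posPart_pow p) (monotone_posPart_pow p) m a
    (fun l t => S t (w l).1.1 (w l).1.2 ^ 2) (fun l t => √2 * S t (w l).1.1 (w l).1.2)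
    (fun l t => (sq_contraction (hentry t _ _) (hentry t (w l).1.1 (w l).1.2)).1)
    (fun l s t => (sq_contraction (hentry s _ _) (hentry t _ _)).2)
  have upper : ∀ ε : Fin m → Bool,
      F (⨆ t, (a t + ∑ l, sgn (ε l) * (√2 * S t (w l).1.1 (w l).1.2))) ≤
        (8 * τ * (pairs n).card / m) ^ p * (rademacherSum M ε ^ (2 * p)).trace := by
    intro ε
    obtain ⟨y, hy0, hyp, hyA⟩ := exists_operator_bound (by omega) (isSymm_rademacherSum hMs ε)
    refine le_trans ?_ (mul_le_mul_of_nonneg_left (hyp p) (by positivity))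
    rw [pow_mul, ← mul_pow]
    refine pow_le_pow_left₀ (le_max_right _ _) (max_le (ciSup_le fun t => ?_) (by positivity)) _
    obtain ⟨hsym, hdiag, -, hnuc, -⟩ := hS t
    have e : ∑ l, sgn (ε l) * (√2 * S t (w l).1.1 (w l).1.2) =
        √2 * traceInner (rademacherSum M ε) (S t) := by
      rw [← sum_sign_apply_eq hsym, Finset.mul_sum]
      exact Finset.sum_congr rfl fun l _ => by ring
    have h1 : traceInner (rademacherSum M ε) (S t) ≤ √τ * frobNorm (S t) * y :=
      (hyA _).trans (mul_le_mul_of_nonneg_right hnuc hy0)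
    rw [e]
    exact offset_bound hm' hΩ hτ (frobNorm_sq_eq hn hsym hdiag) h1
  have hsum : ∑ l, M l * M l = Matrix.diagonal fun i =>
      1 / 4 * ∑ l, (if i = (w l).1.1 ∨ i = (w l).1.2 then (1 : ℝ) else 0) := by
    rw [Finset.sum_congr rfl fun l _ => basisMatrix_mul_self (w l).2]
    ext i j
    rw [Matrix.sum_apply]
    by_cases hij : i = j
    · subst hij
      simp only [Matrix.diagonal_apply_eq, Finset.mul_sum]
    · simp [hij]
  calc _ ≤ _ := lower
    _ ≤ _ := contr
    _ ≤ ∑ ε : Fin m → Bool, (8 * τ * (pairs n).card / m) ^ p *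
        (rademacherSum M ε ^ (2 * p)).trace := Finset.sum_le_sum fun ε _ => upper ε
    _ ≤ _ := by
        rw [← Finset.mul_sum]
        refine mul_le_mul_of_nonneg_left ?_ (by positivity)
        exact sum_trace_rademacherSum_pow_le hMs hs hsum (fun i => by linarith [hw i]) p

end EDMSampling

/-! ### Transfer to probabilities and choice of constants -/

namespace EDMSampling

variable {n m : ℕ}

/-- The uniform measure on the index set of pairs. -/
noncomputable def uniformPairs (n : ℕ) : Measure (pairs n) :=
  ((pairs n).card : ENNReal)⁻¹ • ∑ v : pairs n, Measure.dirac v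

lemma map_uniformPairs (n : ℕ) :
    (uniformPairs n).map (fun v => basisMatrix v.1) = uniformLaw n := by
  ext s hs
  rw [Measure.map_apply (measurable_of_countable _) hs, uniformPairs, uniformLaw]
  simp only [Measure.smul_apply, Measure.finsetSum_apply]
  rw [← Finset.sum_coe_sort (pairs n) fun p => Measure.dirac (basisMatrix p) s]
  congr 1
  refine Finset.sum_congr rfl fun v _ => ?_
  rw [Measure.dirac_apply' _ hs, Measure.dirac_apply]
  rfl

lemma uniformPairs_singleton (v : pairs n) :
    uniformPairs n {v} = ((pairs n).card : ENNReal)⁻¹ := by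
  classical
  rw [uniformPairs]
  simp only [Measure.smul_apply, Measure.finsetSum_apply, Measure.dirac_apply, smul_eq_mul]
  simp [Set.indicator_apply]

lemma isProbabilityMeasure_uniformPairs (hn : 2 ≤ n) :
    IsProbabilityMeasure (uniformPairs n) := by
  have h : (pairs n).card ≠ 0 := by
    have := card_pairs_pos hn
    exact_mod_cast this.ne'
  constructor
  rw [uniformPairs]
  simp only [Measure.smul_apply, Measure.finsetSum_apply, measure_univ, Finset.sum_const,
    Finset.card_univ, Fintype.card_coe, nsmul_eq_mul, mul_one, smul_eq_mul]
  exact ENNReal.inv_mul_cancel (by exact_mod_cast h) (by simp)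

open Classical in
/-- Transfer from counting sampled index tuples to probabilities. -/
lemma one_sub_count_le_measureReal (hn : 2 ≤ n) {S : Type*} [MeasurableSpace S] (P : Measure S)
    [IsProbabilityMeasure P] (X : Fin m → S → Matrix (Fin n) (Fin n) ℝ)
    (hX : ∀ l, HasLaw (X l) (uniformLaw n) P) (hind : iIndepFun X P)
    (G : (Fin m → Matrix (Fin n) (Fin n) ℝ) → Prop) :
    1 - (∑ w : Fin m → pairs n, (if ¬ G (fun l => basisMatrix (w l).1) then (1 : ℝ) else 0)) /
        (Fintype.card (pairs n) : ℝ) ^ m ≤ P.real {s | G fun l => X l s} := by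
  have := isProbabilityMeasure_uniformPairs hn
  set b : (Fin m → pairs n) → Fin m → Matrix (Fin n) (Fin n) ℝ :=
    fun w l => basisMatrix (w l).1 with hb
  set ν : Measure (Fin m → pairs n) := Measure.pi fun _ => uniformPairs n with hν
  have hbm : Measurable b := measurable_of_countable _
  have hmap : P.map (fun s l => X l s) = ν.map b := by
    rw [(iIndepFun_iff_map_fun_eq_pi_map fun l => (hX l).aemeasurable).1 hind]
    have hU : ∀ l, P.map (X l) = (uniformPairs n).map fun v => basisMatrix v.1 := fun l => by
      rw [(hX l).map_eq, map_uniformPairs]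
    simp only [hU]
    have hpm : IsProbabilityMeasure ((uniformPairs n).map fun v => basisMatrix v.1) :=
      Measure.isProbabilityMeasure_map (measurable_of_countable _).aemeasurable
    rw [← Measure.pi_map_pi fun _ => (measurable_of_countable _).aemeasurable]
  set Bd : Finset (Fin m → pairs n) := Finset.univ.filter fun w => ¬ G (b w) with hBd
  -- `G` need not define a measurable set, so the argument passes through the finite, hence
  -- measurable, image of the good tuples.
  set F : Set (Fin m → Matrix (Fin n) (Fin n) ℝ) := b '' {w | G (b w)} with hF
  have hFm : MeasurableSet F := (Set.toFinite _).measurableSet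
  have h1 : P.real ((fun s l => X l s) ⁻¹' F) ≤ P.real {s | G fun l => X l s} := by
    refine measureReal_mono ?_
    rintro s ⟨w, hw, hws⟩
    have hw' : G (b w) := hw
    rw [hws] at hw'
    exact hw'
  have hXm : AEMeasurable (fun s l => X l s) P := aemeasurable_pi_lambda _ fun l =>
    (hX l).aemeasurable
  have h2 : P.real ((fun s l => X l s) ⁻¹' F) = ν.real (b ⁻¹' F) := by
    rw [← map_measureReal_apply_of_aemeasurable hXm hFm, hmap, map_measureReal_apply hbm hFm]
  have h3 : ν.real ((Bd : Set (Fin m → pairs n))ᶜ) ≤ ν.real (b ⁻¹' F) := by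
    refine measureReal_mono ?_
    intro w hw
    refine ⟨w, ?_, rfl⟩
    by_contra h
    exact hw (by simpa [hBd] using h)
  have h4 : ν.real (Bd : Set (Fin m → pairs n)) =
      (∑ w : Fin m → pairs n, (if ¬ G (b w) then (1 : ℝ) else 0)) /
        (Fintype.card (pairs n) : ℝ) ^ m := by
    have hs : ∀ w : Fin m → pairs n, ν.real {w} = ((Fintype.card (pairs n) : ℝ) ^ m)⁻¹ := by
      intro w
      rw [Measure.real, hν, Measure.pi_singleton]
      simp [uniformPairs_singleton, ENNReal.toReal_inv]
    rw [← sum_measureReal_singleton, Finset.sum_congr rfl fun w _ => hs w, Finset.sum_const,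
      ← Finset.sum_filter, Finset.sum_const, nsmul_eq_mul, nsmul_eq_mul, mul_one, div_eq_mul_inv]
  rw [probReal_compl_eq_one_sub Bd.measurableSet, h4] at h3
  linarith

lemma exp_neg_le_inv_pow (hn : 2 ≤ n) {x : ℝ} (hx : Real.log (2 * n) ≤ x) :
    Real.exp (-(4 * x)) ≤ ((2 * n : ℝ) ^ 4)⁻¹ := by
  have h2n : (0 : ℝ) < 2 * n := by positivity
  calc Real.exp (-(4 * x)) ≤ Real.exp (-(4 * Real.log (2 * n))) := Real.exp_le_exp.2 (by linarith)
    _ = _ := by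
      rw [Real.exp_neg, show (4 : ℝ) * Real.log (2 * n) = (4 : ℕ) * Real.log (2 * n) by norm_num,
        Real.exp_nat_mul, Real.exp_log h2n]

/-- The left side is at most 64τωL/ν, the right equals 128τωL/ν. The factor e⁴ in the error term
cancels exp(-4), so each moment order gains a factor e⁻⁴. -/
lemma moment_base_le {ν μ τ ω L x : ℝ} (hν : 0 < ν) (hμ : 0 < μ) (hω : 0 < τ * ω)
    (hL : 0 ≤ L) (hx : x ≤ 2 * L) :
    8 * τ * ω / μ * (2 * x * (2 * (μ / ν))) ≤
      Real.exp (-4) * (μ * (256 * Real.exp 4 * τ * ω * (L / (ν * μ))) / 2) := by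
  have e1 : 8 * τ * ω / μ * (2 * x * (2 * (μ / ν))) = 32 * (τ * ω) / ν * x := by
    field_simp; ring
  have e2 : Real.exp (-4) * (μ * (256 * Real.exp 4 * τ * ω * (L / (ν * μ))) / 2) =
      32 * (τ * ω) / ν * (4 * L) := by
    rw [Real.exp_neg]
    have := Real.exp_pos 4
    field_simp; ring
  rw [e1, e2]
  exact mul_le_mul_of_nonneg_left (by linarith) (by positivity)

lemma eight_mul_le_inv {x : ℝ} (hx : 2 ≤ x) : 8 * (x * ((2 * x) ^ 4)⁻¹) ≤ 1 / x := by
  have hx0 : 0 < x := by linarith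
  have e : 8 * (x * ((2 * x) ^ 4)⁻¹) = 1 / x * (1 / (2 * x ^ 2)) := by
    field_simp; norm_num
  rw [e]
  refine mul_le_of_le_one_right (by positivity) ?_
  rw [div_le_one (by positivity)]
  nlinarith

/-- The second moment threshold enters here: it supplies the hypothesis of `lower_tail_count`. -/
lemma sixteen_le_of_sqrt_le {ν μ E : ℝ} (hν : 2 ≤ ν) (hμ : 1 ≤ μ)
    (h : √(256 * Real.log (2 * ν) / (μ * Real.log 2)) ≤ E) : 16 ≤ μ * E := by
  have hμ0 : 0 < μ := by linarith
  have hl2 : 0 < Real.log 2 := Real.log_pos (by norm_num)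
  have hl2' : Real.log 2 ≤ Real.log (2 * ν) := Real.log_le_log (by norm_num) (by linarith)
  have h1 : 16 / μ ≤ √(256 * Real.log (2 * ν) / (μ * Real.log 2)) := by
    refine Real.le_sqrt_of_sq_le ?_
    calc (16 / μ) ^ 2 = 256 / μ * (1 / μ) := by field_simp; norm_num
      _ ≤ 256 / μ * (Real.log (2 * ν) / Real.log 2) := by
          refine mul_le_mul_of_nonneg_left ?_ (by positivity)
          exact ((div_le_one hμ0).2 hμ).trans ((one_le_div hl2).2 hl2')
      _ = _ := by field_simp
  have h2 := h1.trans h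
  rw [div_le_iff₀ hμ0] at h2
  linarith

open Classical in
-- Union bound over indices. The mean degree is 2m/n, so the threshold 8m/n leaves the exponent
-- -4m/n, at most -4 log(2n).
lemma sum_degree_excess_le (hn : 2 ≤ n) (hm : (n : ℝ) * Real.log (2 * n) ≤ m) :
    ∑ w : Fin m → pairs n, ∑ i : Fin n, (if 8 * ((m : ℝ) / n) <
        ∑ l, (if i = (w l).1.1 ∨ i = (w l).1.2 then (1 : ℝ) else 0) then (1 : ℝ) else 0) ≤
      (Fintype.card (pairs n) : ℝ) ^ m * (n * ((2 * n : ℝ) ^ 4)⁻¹) := by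
  have hn0 : (0 : ℝ) < n := by positivity
  rw [Finset.sum_comm]
  calc _ ≤ ∑ i : Fin n, (Fintype.card (pairs n) : ℝ) ^ m * ((2 * n : ℝ) ^ 4)⁻¹ := by
        refine Finset.sum_le_sum fun i _ => ?_
        refine (upper_tail_count (fun v : pairs n => i = v.1.1 ∨ i = v.1.2)
          (t := 8 * ((m : ℝ) / n)) (sum_pairs_incidence_eq hn i)).trans ?_
        refine mul_le_mul_of_nonneg_left ?_ (by positivity)
        rw [show 2 * ((m : ℝ) * (2 / n)) - 8 * (m / n) = -(4 * (m / n)) by ring]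
        refine exp_neg_le_inv_pow hn ?_
        rw [le_div_iff₀ hn0]
        linarith
    _ = _ := by
        rw [Finset.sum_const, Finset.card_univ, Fintype.card_fin, nsmul_eq_mul]; ring

lemma le_of_pow_mul_le {a b K c T : ℝ} {p : ℕ} (hK : 0 < K) (hab : 0 ≤ a * b) (hT : 0 ≤ T)
    (h : a * b ≤ Real.exp (-4) * K) (hc : K ^ p * c ≤ a ^ p * (b ^ p * T)) :
    c ≤ T * Real.exp (-(4 * p)) := by
  refine le_of_mul_le_mul_left (hc.trans ?_) (pow_pos hK p)
  calc a ^ p * (b ^ p * T) = (a * b) ^ p * T := by rw [mul_pow, mul_assoc]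
    _ ≤ (Real.exp (-4) * K) ^ p * T :=
        mul_le_mul_of_nonneg_right (pow_le_pow_left₀ hab h p) hT
    _ = _ := by
        rw [mul_pow, ← Real.exp_nat_mul, show (p : ℝ) * -4 = -(4 * p) by ring]; ring

open Classical in
lemma bad_count_le (hn : 2 ≤ n) {τ : ℝ} (hτ : 0 < τ)
    (hm : (n : ℝ) * Real.log (2 * n) < m) :
    ∑ w : Fin m → pairs n, (if ∃ A : coneSet n m τ, ∑ l, A.1 (w l).1.1 (w l).1.2 ^ 2 <
        m * (1 / 2 * secondMoment A.1 - 256 * Real.exp 4 * τ * (pairs n).card *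
          (Real.log (2 * n) / (n * m))) then (1 : ℝ) else 0) ≤
      (Fintype.card (pairs n) : ℝ) ^ m * (1 / n) := by
  have hn2 : (2 : ℝ) ≤ n := by exact_mod_cast hn
  have hn0 : (0 : ℝ) < n := by linarith
  have hlog1 : 1 ≤ Real.log (2 * n) := by
    rw [Real.le_log_iff_exp_le (by positivity)]
    linarith [Real.exp_one_lt_d9]
  have hm0' : (0 : ℝ) < m := lt_of_le_of_lt (by positivity) hm
  have hm0 : 0 < m := Nat.cast_pos.1 hm0'
  have hm1 : (1 : ℝ) ≤ m := by exact_mod_cast hm0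
  have hΩ := card_pairs_pos hn
  set L := Real.log (2 * n) with hL
  set R := 256 * Real.exp 4 * τ * (pairs n).card * (L / (n * m)) with hR
  have hR0 : 0 < R := by positivity
  set N : ℝ := (Fintype.card (pairs n) : ℝ) with hN
  have hN0 : 0 < N := by rw [hN, Fintype.card_coe]; exact hΩ
  have hne : Nonempty (pairs n) := Fintype.card_pos_iff.1 (Nat.cast_pos.1 hN0)
  have hlarge : ∀ A : coneSet n m τ, 16 ≤ m * secondMoment A.1 := by
    intro A
    obtain ⟨-, -, -, -, h⟩ := A.2
    exact sixteen_le_of_sqrt_le hn2 hm1 h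
  have hsymm := symmetrization_count (m := m)
    (fun (A : coneSet n m τ) (v : pairs n) => A.1 v.1.1 v.1.2 ^ 2)
    (fun A => m * (1 / 2 * secondMoment A.1 - R)) (fun A => 3 / 4 * (m * secondMoment A.1))
    (fun A => lower_tail_count _ (fun v => sq_nonneg _) (fun v => by
        obtain ⟨-, -, hmax, -, -⟩ := A.2
        have h := abs_apply_le_maxNorm A.1 v.1.1 v.1.2
        rw [hmax] at h
        have h2 := pow_le_pow_left₀ (abs_nonneg _) h 2
        rw [sq_abs, div_pow, Real.sq_sqrt (by norm_num)] at h2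
        linarith)
      (sum_sq_eq_card_mul_secondMoment hn A.2.1) (hlarge A))
  have harg : ∀ A : coneSet n m τ, (3 / 4 * (m * secondMoment A.1) -
      m * (1 / 2 * secondMoment A.1 - R)) / 2 = m * (secondMoment A.1 / 4 + R) / 2 :=
    fun A => by ring
  simp only [harg] at hsymm
  set cnt : (Fin m → pairs n) → ℝ := fun w => ∑ ε : Fin m → Bool,
    (if ∃ A : coneSet n m τ, m * (secondMoment A.1 / 4 + R) / 2 ≤
      ∑ l, sgn (ε l) * A.1 (w l).1.1 (w l).1.2 ^ 2 then (1 : ℝ) else 0) with hcnt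
  set deg : Fin n → (Fin m → pairs n) → ℝ := fun i w =>
    ∑ l, (if i = (w l).1.1 ∨ i = (w l).1.2 then (1 : ℝ) else 0) with hdeg
  set g : (Fin m → pairs n) → ℝ := fun w =>
    ∑ i, (if 8 * (m / n) < deg i w then (1 : ℝ) else 0) with hg
  set δ : ℝ := n * ((2 * n : ℝ) ^ 4)⁻¹ with hδ
  have hδ0 : 0 ≤ δ := by positivity
  have hg0 : ∀ w, 0 ≤ g w := fun w => Finset.sum_nonneg fun i _ => by positivity
  have hcnt_le : ∀ w, cnt w ≤ 2 ^ m := fun w => by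
    calc cnt w ≤ ∑ ε : Fin m → Bool, (1 : ℝ) :=
          Finset.sum_le_sum fun ε _ => by split_ifs <;> norm_num
      _ = 2 ^ m := by simp
  -- Either some degree is too large, so `g w` is at least 1 and the trivial bound suffices, or the
  -- conditional moment bound applies.
  have hgood : ∀ w, cnt w ≤ 2 ^ m * (g w + δ) := by
    intro w
    by_cases hw : ∃ i, 8 * (m / n) < deg i w
    · obtain ⟨i, hi⟩ := hw
      have : 1 ≤ g w := by
        have := Finset.single_le_sum (f := fun i =>
          (if 8 * (m / n) < deg i w then (1 : ℝ) else 0)) (fun i _ => by positivity)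
          (Finset.mem_univ i)
        simpa only [if_pos hi] using this
      calc cnt w ≤ 2 ^ m * 1 := by rw [mul_one]; exact hcnt_le w
        _ ≤ _ := mul_le_mul_of_nonneg_left (by linarith) (by positivity)
    · push Not at hw
      -- Rounding up gives e^(-4p) ≤ (2n)⁻⁴, which beats the dimension factor n from the trace; `p`
      -- is at most 2L since L ≥ 1.
      set p := ⌈L⌉₊ with hp
      have hp1 : L ≤ p := Nat.le_ceil L
      have hp2 : (p : ℝ) ≤ 2 * L := by
        have := Nat.ceil_lt_add_one (by linarith : 0 ≤ L)
        linarith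
      have hsc := sign_count_le hn hm0 hτ (s := 2 * (m / n)) (by positivity) hR0.le w
        (fun i => (hw i).trans (le_of_eq (by ring))) p
      have hbase : 8 * τ * (pairs n).card / m * (2 * p * (2 * (m / n))) ≤
          Real.exp (-4) * (m * R / 2) :=
        moment_base_le hn0 hm0' (mul_pos hτ hΩ) (le_trans zero_le_one hlog1) hp2
      have hfin : cnt w ≤ 2 ^ m * δ := by
        refine (le_of_pow_mul_le (half_pos (mul_pos hm0' hR0))
          (mul_nonneg (by positivity) (by positivity)) (by positivity) hbase hsc).trans ?_
        rw [mul_assoc]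
        exact mul_le_mul_of_nonneg_left (mul_le_mul_of_nonneg_left
          (exp_neg_le_inv_pow hn hp1) hn0.le) (by positivity)
      calc cnt w ≤ 2 ^ m * δ := hfin
        _ ≤ _ := mul_le_mul_of_nonneg_left (by linarith [hg0 w]) (by positivity)
  have hgsum : ∑ w, g w ≤ N ^ m * δ := by
    exact sum_degree_excess_le hn hm.le
  have htotal : ∑ w, cnt w ≤ 2 ^ m * (2 * (N ^ m * δ)) := by
    calc ∑ w, cnt w ≤ ∑ w, 2 ^ m * (g w + δ) := Finset.sum_le_sum fun w _ => hgood w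
      _ = 2 ^ m * (∑ w, g w + N ^ m * δ) := by
          rw [← Finset.mul_sum, Finset.sum_add_distrib, Finset.sum_const, Finset.card_univ,
            Fintype.card_fun, Fintype.card_fin, nsmul_eq_mul, Nat.cast_pow]
      _ ≤ _ := mul_le_mul_of_nonneg_left (by linarith) (by positivity)
  -- The factor 8 combines 4 from symmetrization with 2 from the two sources of failure, each
  -- contributing δ.
  have h8 : 8 * δ ≤ 1 / n := eight_mul_le_inv hn2
  refine le_of_mul_le_mul_right (hsymm.trans ?_) (by positivity : (0 : ℝ) < 2 ^ m)
  calc 4 * ∑ w, cnt w ≤ 4 * (2 ^ m * (2 * (N ^ m * δ))) :=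
        mul_le_mul_of_nonneg_left htotal (by norm_num)
    _ = N ^ m * (8 * δ) * 2 ^ m := by ring
    _ ≤ _ := mul_le_mul_of_nonneg_right
        (mul_le_mul_of_nonneg_left h8 (pow_pos hN0 m).le) (by positivity)

end EDMSampling

theorem lemma4p3 :
    ∃ C₂ : ℝ, 0 < C₂ ∧
      ∀ (C₁ : ℝ), 1 < C₁ → ∀ (n m : ℕ) (τ : ℝ), 2 ≤ n → 0 < τ →
        C₁ * n * Real.log (2 * n) < m →
        ∀ {S : Type*} [MeasurableSpace S] (P : Measure S) [IsProbabilityMeasure P]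
          (X : Fin m → S → Matrix (Fin n) (Fin n) ℝ),
          (∀ l, HasLaw (X l) (EDMSampling.uniformLaw n) P) →
          iIndepFun X P →
          1 - 1 / (n : ℝ) ≤
            P.real {s | ∀ A ∈ EDMSampling.coneSet n m τ,
              1 / 2 * EDMSampling.secondMoment A -
                  256 * C₂ * τ * (EDMSampling.pairs n).card * (Real.log (2 * n) / (n * m)) ≤
                1 / m * ‖EDMSampling.observe (fun l => X l s) A‖ ^ 2} := by
  classical
  refine ⟨Real.exp 4, Real.exp_pos 4, ?_⟩
  intro C₁ hC₁ n m τ hn hτ hm S _ P _ X hX hind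
  have hn2 : (2 : ℝ) ≤ n := by exact_mod_cast hn
  have hlog : 0 ≤ Real.log (2 * n) := Real.log_nonneg (by linarith)
  have hm' : (n : ℝ) * Real.log (2 * n) < m := by
    refine lt_of_le_of_lt ?_ hm
    rw [mul_assoc]
    exact le_mul_of_one_le_left (by positivity) hC₁.le
  have hm0 : (0 : ℝ) < m := lt_of_le_of_lt (by positivity) hm'
  have hN : (0 : ℝ) < (Fintype.card (EDMSampling.pairs n) : ℝ) ^ m := by
    rw [Fintype.card_coe]
    exact pow_pos (EDMSampling.card_pairs_pos hn) m
  refine le_trans ?_ (EDMSampling.one_sub_count_le_measureReal hn P X hX hind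
    fun M => ∀ A ∈ EDMSampling.coneSet n m τ, 1 / 2 * EDMSampling.secondMoment A -
      256 * Real.exp 4 * τ * (EDMSampling.pairs n).card * (Real.log (2 * n) / (n * m)) ≤
        1 / m * ‖EDMSampling.observe M A‖ ^ 2)
  refine sub_le_sub_left ?_ 1
  rw [div_le_iff₀ hN, mul_comm (1 / (n : ℝ))]
  refine le_trans (Finset.sum_le_sum fun w _ => ?_) (EDMSampling.bad_count_le hn hτ hm')
  by_cases hw : ∀ A ∈ EDMSampling.coneSet n m τ, 1 / 2 * EDMSampling.secondMoment A -
      256 * Real.exp 4 * τ * (EDMSampling.pairs n).card * (Real.log (2 * n) / (n * m)) ≤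
        1 / m * ‖EDMSampling.observe (fun l => EDMSampling.basisMatrix (w l).1) A‖ ^ 2
  · rw [if_neg (not_not.2 hw)]
    positivity
  · rw [if_pos hw, if_pos]
    push Not at hw
    obtain ⟨A, hA, h⟩ := hw
    refine ⟨⟨A, hA⟩, ?_⟩
    have e : ‖EDMSampling.observe (fun l => EDMSampling.basisMatrix (w l).1) A‖ ^ 2 =
        ∑ l, A (w l).1.1 (w l).1.2 ^ 2 := by
      rw [EuclideanSpace.real_norm_sq_eq]
      refine Finset.sum_congr rfl fun l _ => ?_
      rw [← EDMSampling.traceInner_basisMatrix hA.1, EDMSampling.traceInner_comm]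
      rfl
    rw [e, one_div, inv_mul_lt_iff₀ hm0] at h
    exact h
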